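/- Corollary 3 (Converse Measure Concentration). Let $A$ be a finite set, $P$ a probability mass function on $A$ with $P(a)>0$ for all $a\in A$, and $\rho:A\times A\to[0,\infty)$ a function such that for each $a\in A$ there is a $b\in A$ with $\rho(a,b)=0$. For $n\ge 1$, $x,y\in A^n$ and $C\subseteq A^n$ write $\rho_n(x,y)=\frac1n\sum_{i=1}^n\rho(x_i,y_i)$, $\rho_n(x,C)=\min_{y\in C}\rho_n(x,y)$ (for $C\neq\emptyset$), $[C]_D=\{x\in A^n:\rho_n(x,y)\le D\text{ for some }y\in C\}$ and $P^n(C)=\sum_{y\in C}\prod_{i=1}^nP(y_i)$. For $D\ge 0$ let $$R_C(D)=\inf_Q\Big\{\inf_{W\in\mathcal M(P,Q,D)}H(W\|P\times Q)+\sum_{y\in A}Q(y)\log P(y)\Big\},$$ where $Q$ ranges over all probability mass functions on $A$; $\mathcal M(P,Q,D)$ is the set of probability mass functions $W$ on $A\times A$ with first marginal $P$, second marginal $Q$ and $\sum_{x,y}W(x,y)\rho(x,y)\le D$; $H(\mu\|\nu)=\sum_s\mu(s)\log\frac{\mu(s)}{\nu(s)}$ is relative entropy; and the inner infimum is $+\infty$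 if $\mathcal M(P,Q,D)$ is empty. Here $\log$ is the natural logarithm. Then: (i) For every $n\ge1$ and every nonempty $C_n\subseteq A^n$, if $D=\sum_{x\in A^n}P^n(\{x\})\,\rho_n(x,C_n)$, then $P^n(C_n)\ge e^{nR_C(D)}$. (ii) For every $D\ge0$ and every sequence of sets $C_n\subseteq A^n$, if $P^n([C_n]_D)\to1$ as $n\to\infty$, then $\liminf_{n\to\infty}\frac1n\log P^n(C_n)\ge R_C(D)$. (iii) For every $D\ge0$ there is a sequence of sets $C_n\subseteq A^n$ such that $P^n([C_n]_D)\to1$ and $\frac1n\log P^n(C_n)\to R_C(D)$ as $n\to\infty$. -/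

import Mathlib

open Filter Topology

noncomputable section

namespace SphereCovering

variable {A : Type*}

/-- The single-letter distortion `ρₙ(x, y) = (1/n) ∑ᵢ ρ(xᵢ, yᵢ)` on `Aⁿ`. -/
def distortion (ρ : A → A → ℝ) {n : ℕ} (x y : Fin n → A) : ℝ :=
  (1 / (n : ℝ)) * ∑ i, ρ (x i) (y i)

/-- The distortion `ρₙ(x, C) = min_{y ∈ C} ρₙ(x, y)` from a point to a nonempty set. -/
def distortionTo (ρ : A → A → ℝ) {n : ℕ} (C : Finset (Fin n → A)) (hC : C.Nonempty)
    (x : Fin n → A) : ℝ :=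
  C.inf' hC (fun y => distortion ρ x y)

/-- The product mass `Mⁿ(C) = ∑_{y ∈ C} ∏ᵢ M(yᵢ)` of a set `C ⊆ Aⁿ`. -/
def mass (M : A → ℝ) {n : ℕ} (C : Finset (Fin n → A)) : ℝ :=
  ∑ y ∈ C, ∏ i, M (y i)

variable [Fintype A]

open Classical in
/-- The `D`-blowup `[C]_D = {x : ρₙ(x, y) ≤ D for some y ∈ C}`. -/
def blowup (ρ : A → A → ℝ) (D : ℝ) {n : ℕ} (C : Finset (Fin n → A)) : Finset (Fin n → A) :=
  Finset.univ.filter (fun x => ∃ y ∈ C, distortion ρ x y ≤ D)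

open Classical in
/-- The average distortion `E_{Pⁿ}[ρₙ(X₁ⁿ, C)]` of a nonempty set `C ⊆ Aⁿ`. -/
def avgDistortion (P : A → ℝ) (ρ : A → A → ℝ) {n : ℕ} (C : Finset (Fin n → A))
    (hC : C.Nonempty) : ℝ :=
  ∑ x : Fin n → A, (∏ i, P (x i)) * distortionTo ρ C hC x

open Classical in
/-- The relative entropy `H(μ‖ν) = ∑ₛ μ(s) log (μ(s)/ν(s))` of probability mass functions on a
finite set, with `0 log (0/q) = 0` for all `q ≥ 0`, and `p log (p/0) = ∞` for `p > 0`. -/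
def relEntropy {S : Type*} [Fintype S] (μ ν : S → ℝ) : EReal :=
  if ∀ s, ν s = 0 → μ s = 0 then ((∑ s, μ s * Real.log (μ s / ν s) : ℝ) : EReal) else ⊤

/-- The set `ℳ(P, Q, D)` of probability mass functions `W` on `A × A` with first marginal `P`,
second marginal `Q`, and `E_W[ρ(X, Y)] ≤ D`. -/
def couplings (ρ : A → A → ℝ) (P Q : A → ℝ) (D : ℝ) : Set (A × A → ℝ) :=
  {W | W ∈ stdSimplex ℝ (A × A) ∧ (∀ x, ∑ y, W (x, y) = P x) ∧ (∀ y, ∑ x, W (x, y) = Q y) ∧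
    ∑ x, ∑ y, W (x, y) * ρ x y ≤ D}

/-- `I(P, Q, D) = inf_{W ∈ ℳ(P, Q, D)} H(W ‖ P × Q)`, equal to `∞` if `ℳ(P, Q, D)` is empty. -/
def infoRate (ρ : A → A → ℝ) (P Q : A → ℝ) (D : ℝ) : EReal :=
  ⨅ W ∈ couplings ρ P Q D, relEntropy W (fun s : A × A => P s.1 * Q s.2)

/-- The rate function `R(D; P, M) = inf_Q { I(P, Q, D) + E_Q[log M(Y)] }`, the infimum being over
all probability mass functions `Q` on `A`. -/
def rate (ρ : A → A → ℝ) (P M : A → ℝ) (D : ℝ) : EReal :=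
  ⨅ Q ∈ stdSimplex ℝ A, infoRate ρ P Q D + ((∑ y, Q y * Real.log (M y) : ℝ) : EReal)

/-- The concentration exponent `R_C(D) = R(D; P, P)`. -/
def concExponent (ρ : A → A → ℝ) (P : A → ℝ) (D : ℝ) : EReal :=
  rate ρ P P D

end SphereCovering

end

noncomputable section

namespace SphereCovering

variable {A : Type*} [Fintype A]

/-! The two infima merge into one: the exponent is the minimum of `objective P W` over joint laws
`W` with first marginal `P` and distortion at most `D`. This set is compact and the objective is
continuous on it, so the minimum is attained. Converse (`exp_objective_le_mass`): send each word to
a nearest codeword and average the joint laws of the coordinates. The resulting `W` has distortion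
equal to the average distortion of the code. Jensen's inequality bounds `exp (n * objective)` by a
sum in which the weights `P (x i)` cancel and the backward channel `W / Q` remains. The channel sums
to at most one over each fibre, which leaves the mass of the code. For the limit inferior, bounded
distortion makes the average distortion at most `D + o(1)`, and semicontinuity of the exponent
(`exists_pos_forall_lt_objective`) absorbs the error. Achievability (`eventually_exists_code`):
about `exp (n I)` words cover almost everything, where `I` is the mutual information of `W`. Only
words of mass at most about `exp (n E)` are kept, where `E` is the mean of `log P` under the second
marginal, and `I + E` is the objective. -/

/-- The second marginal of a function on `A × A`. -/
def sndMarginal (W : A × A → ℝ) (y : A) : ℝ := ∑ x, W (x, y)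

/-- The expected distortion `E_W[ρ(X, Y)]`. -/
def expDistortion (ρ : A → A → ℝ) (W : A × A → ℝ) : ℝ := ∑ x, ∑ y, W (x, y) * ρ x y

/-- The mass functions on `A × A` with first marginal `P` and expected distortion at most `D`. -/
def rateCouplings (ρ : A → A → ℝ) (P : A → ℝ) (D : ℝ) : Set (A × A → ℝ) :=
  {W | W ∈ stdSimplex ℝ (A × A) ∧ (∀ x, ∑ y, W (x, y) = P x) ∧ expDistortion ρ W ≤ D}

/-- The relative entropy of `W` with respect to the product of `P` and the second marginal
of `W`. -/
def mutualInfo (P : A → ℝ) (W : A × A → ℝ) : ℝ :=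
  ∑ s, W s * Real.log (W s / (P s.1 * sndMarginal W s.2))

/-- The functional minimised by the concentration exponent. -/
def objective (P : A → ℝ) (W : A × A → ℝ) : ℝ :=
  mutualInfo P W + ∑ y, sndMarginal W y * Real.log (P y)

/-! ### Couplings with a given first marginal: compactness and continuity -/

section Basic

variable {W : A × A → ℝ} {P : A → ℝ} {ρ : A → A → ℝ} {D : ℝ}

lemma sndMarginal_nonneg (hW : ∀ s, 0 ≤ W s) (y : A) : 0 ≤ sndMarginal W y :=
  Finset.sum_nonneg fun _ _ => hW _

lemma le_sndMarginal (hW : ∀ s, 0 ≤ W s) (s : A × A) : W s ≤ sndMarginal W s.2 :=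
  Finset.single_le_sum (f := fun x => W (x, s.2)) (fun _ _ => hW _) (Finset.mem_univ s.1)

lemma sndMarginal_mem (hW : W ∈ stdSimplex ℝ (A × A)) : sndMarginal W ∈ stdSimplex ℝ A := by
  refine ⟨sndMarginal_nonneg hW.1, ?_⟩
  rw [← hW.2, Fintype.sum_prod_type_right]
  rfl

lemma sum_mul_snd (W : A × A → ℝ) (g : A → ℝ) :
    ∑ s : A × A, W s * g s.2 = ∑ y, sndMarginal W y * g y := by
  simp only [Fintype.sum_prod_type_right, sndMarginal, Finset.sum_mul]

lemma expDistortion_eq (ρ : A → A → ℝ) (W : A × A → ℝ) :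
    expDistortion ρ W = ∑ s : A × A, W s * ρ s.1 s.2 := by
  simp only [Fintype.sum_prod_type, expDistortion]

lemma continuous_sndMarginal (y : A) : Continuous fun W : A × A → ℝ => sndMarginal W y := by
  unfold sndMarginal; fun_prop

lemma continuous_expDistortion (ρ : A → A → ℝ) : Continuous (expDistortion ρ) := by
  unfold expDistortion; fun_prop

lemma rateCouplings_mono {D' : ℝ} (h : D ≤ D') :
    rateCouplings ρ P D ⊆ rateCouplings ρ P D' :=
  fun _ hW => ⟨hW.1, hW.2.1, hW.2.2.trans h⟩

lemma isCompact_rateCouplings (ρ : A → A → ℝ) (P : A → ℝ) (D : ℝ) :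
    IsCompact (rateCouplings ρ P D) := by
  have : rateCouplings ρ P D = stdSimplex ℝ (A × A) ∩
      ((⋂ x, {W | ∑ y, W (x, y) = P x}) ∩ {W | expDistortion ρ W ≤ D}) := by
    ext W
    simp only [rateCouplings, Set.mem_inter_iff, Set.mem_iInter, Set.mem_ofPred_eq]
  rw [this]
  refine (isCompact_stdSimplex ℝ (A × A)).inter_right (IsClosed.inter ?_ ?_)
  · exact isClosed_iInter fun x => isClosed_eq (by fun_prop) continuous_const
  · exact isClosed_le (continuous_expDistortion ρ) continuous_const

/-- Where `W s` is positive, so is the second marginal that dominates it; elsewhere every term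
vanishes. The split form only involves functions `t * log t` and linear ones, hence is continuous up
to the boundary of the simplex. -/
lemma mul_log_div_eq (hPpos : ∀ a, 0 < P a) (hW : ∀ s, 0 ≤ W s) (s : A × A) :
    W s * Real.log (W s / (P s.1 * sndMarginal W s.2)) =
      W s * Real.log (W s) - W s * Real.log (P s.1) - W s * Real.log (sndMarginal W s.2) := by
  rcases (hW s).eq_or_lt with h | h
  · simp [← h]
  · have hQ := h.trans_le (le_sndMarginal hW s)
    rw [Real.log_div h.ne' (mul_pos (hPpos _) hQ).ne', Real.log_mul (hPpos _).ne' hQ.ne']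
    ring

lemma objective_eq (hPpos : ∀ a, 0 < P a) (hW : ∀ s, 0 ≤ W s) :
    objective P W = ∑ s, W s * Real.log (W s) - ∑ s, W s * Real.log (P s.1)
      - ∑ y, sndMarginal W y * Real.log (sndMarginal W y)
      + ∑ y, sndMarginal W y * Real.log (P y) := by
  unfold objective mutualInfo
  simp only [mul_log_div_eq hPpos hW, Finset.sum_sub_distrib]
  rw [sum_mul_snd W fun y => Real.log (sndMarginal W y)]

lemma continuousOn_objective (hPpos : ∀ a, 0 < P a) :
    ContinuousOn (objective P) (rateCouplings ρ P D) := by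
  refine ContinuousOn.congr (Continuous.continuousOn ?_) fun W hW => objective_eq hPpos hW.1.1
  have h1 : ∀ s : A × A, Continuous fun W : A × A → ℝ => W s * Real.log (W s) :=
    fun s => Real.continuous_mul_log.comp (continuous_apply s)
  have h2 : ∀ y : A, Continuous fun W : A × A → ℝ =>
      sndMarginal W y * Real.log (sndMarginal W y) :=
    fun y => Real.continuous_mul_log.comp (continuous_sndMarginal y)
  have h3 := continuous_sndMarginal (A := A)
  fun_prop

/-- Termwise `log t ≥ 1 - 1 / t`; the resulting lower bounds `W - P × Q` sum to zero. -/
lemma mutualInfo_nonneg (hP : P ∈ stdSimplex ℝ A) (hPpos : ∀ a, 0 < P a)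
    (hW : W ∈ stdSimplex ℝ (A × A)) : 0 ≤ mutualInfo P W := by
  have hsum : ∑ s : A × A, (W s - P s.1 * sndMarginal W s.2) = 0 := by
    rw [Finset.sum_sub_distrib, hW.2, Fintype.sum_prod_type]
    simp only [← Finset.mul_sum, (sndMarginal_mem hW).2, mul_one, hP.2, sub_self]
  rw [← hsum]
  refine Finset.sum_le_sum fun s _ => ?_
  rcases (hW.1 s).eq_or_lt with h | h
  · rw [← h]
    have := mul_nonneg (hPpos s.1).le (sndMarginal_nonneg hW.1 s.2)
    simpa using this
  · have hPQ := mul_pos (hPpos s.1) (h.trans_le (le_sndMarginal hW.1 s))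
    have h1 := Real.one_sub_inv_le_log_of_pos (div_pos h hPQ)
    calc W s - P s.1 * sndMarginal W s.2
        = W s * (1 - (W s / (P s.1 * sndMarginal W s.2))⁻¹) := by field_simp
      _ ≤ _ := mul_le_mul_of_nonneg_left h1 h.le

/-- Each letter is paired with a letter at zero distortion. This coupling shows that the
minimisation is feasible, and mixing with it later creates slack in the distortion constraint. -/
lemma exists_rateCouplings_zero (hP : P ∈ stdSimplex ℝ A) (hρ0 : ∀ a, ∃ b, ρ a b = 0) :
    ∃ W ∈ rateCouplings ρ P 0, expDistortion ρ W = 0 := by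
  classical
  choose g hg using hρ0
  have hd : expDistortion ρ (fun s : A × A => if s.2 = g s.1 then P s.1 else 0) = 0 := by
    simp [expDistortion, hg]
  refine ⟨fun s => if s.2 = g s.1 then P s.1 else 0, ⟨⟨fun s => ?_, ?_⟩, fun x => ?_, hd.le⟩, hd⟩
  · dsimp only
    split_ifs
    · exact hP.1 _
    · exact le_rfl
  · simp [Fintype.sum_prod_type, hP.2]
  · simp

end Basic

/-! ### The exponent as a minimum over couplings -/

section Exponent

variable {W : A × A → ℝ} {P : A → ℝ} {ρ : A → A → ℝ} {D : ℝ}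

lemma relEntropy_eq_mutualInfo (hW : ∀ s, 0 ≤ W s) (hPpos : ∀ a, 0 < P a) :
    relEntropy W (fun s : A × A => P s.1 * sndMarginal W s.2) = (mutualInfo P W : EReal) := by
  rw [relEntropy, if_pos]
  · rfl
  · intro s hs
    have h2 : sndMarginal W s.2 = 0 := (mul_eq_zero.1 hs).resolve_left (hPpos _).ne'
    exact le_antisymm (h2 ▸ le_sndMarginal hW s) (hW s)

lemma concExponent_le_objective (hPpos : ∀ a, 0 < P a) (hW : W ∈ rateCouplings ρ P D) :
    concExponent ρ P D ≤ (objective P W : EReal) := by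
  refine (iInf₂_le (sndMarginal W) (sndMarginal_mem hW.1)).trans ?_
  rw [objective, EReal.coe_add]
  gcongr
  refine (iInf₂_le W ⟨hW.1, hW.2.1, fun _ => rfl, hW.2.2⟩).trans ?_
  exact (relEntropy_eq_mutualInfo hW.1.1 hPpos).le

lemma le_concExponent (hPpos : ∀ a, 0 < P a) {c : ℝ}
    (h : ∀ W ∈ rateCouplings ρ P D, c ≤ objective P W) :
    (c : EReal) ≤ concExponent ρ P D := by
  refine le_iInf₂ fun Q _ => ?_
  have : ((c - ∑ y, Q y * Real.log (P y) : ℝ) : EReal) ≤ infoRate ρ P Q D := by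
    refine le_iInf₂ fun W hW => ?_
    obtain rfl : sndMarginal W = Q := funext hW.2.2.1
    rw [relEntropy_eq_mutualInfo hW.1.1 hPpos, EReal.coe_le_coe_iff, sub_le_iff_le_add]
    exact h W ⟨hW.1, hW.2.1, hW.2.2.2⟩
  calc (c : EReal) = ((c - ∑ y, Q y * Real.log (P y) : ℝ) : EReal)
        + ((∑ y, Q y * Real.log (P y) : ℝ) : EReal) := by
        rw [← EReal.coe_add, sub_add_cancel]
    _ ≤ _ := by gcongr

/-- The infimum defining the concentration exponent is attained. -/
lemma exists_concExponent_eq (hP : P ∈ stdSimplex ℝ A) (hPpos : ∀ a, 0 < P a)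
    (hρ0 : ∀ a, ∃ b, ρ a b = 0) (hD : 0 ≤ D) :
    ∃ W ∈ rateCouplings ρ P D, concExponent ρ P D = (objective P W : EReal) := by
  obtain ⟨W₀, hW₀, -⟩ := exists_rateCouplings_zero hP hρ0
  obtain ⟨W, hW, hmin⟩ := (isCompact_rateCouplings ρ P D).exists_isMinOn
    ⟨W₀, rateCouplings_mono hD hW₀⟩ (continuousOn_objective hPpos)
  exact ⟨W, hW, le_antisymm (concExponent_le_objective hPpos hW)
    (le_concExponent hPpos fun V hV => hmin hV)⟩

/-- Lower semicontinuity from the right of the concentration exponent. -/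
lemma exists_pos_forall_lt_objective (hPpos : ∀ a, 0 < P a) {c : ℝ}
    (hc : (c : EReal) < concExponent ρ P D) :
    ∃ ε > 0, ∀ W ∈ rateCouplings ρ P (D + ε), c < objective P W := by
  -- The least distortion on this compact sublevel set exceeds `D`, since otherwise the exponent at
  -- `D` would be at most `c`. Half of the gap serves as `ε`.
  have hK : IsCompact (rateCouplings ρ P (D + 1) ∩ objective P ⁻¹' Set.Iic c) := by
    refine (isCompact_rateCouplings ρ P (D + 1)).of_isClosed_subset ?_ Set.inter_subset_left
    exact (continuousOn_objective hPpos).preimage_isClosed_of_isClosed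
      (isCompact_rateCouplings ρ P (D + 1)).isClosed isClosed_Iic
  rcases (rateCouplings ρ P (D + 1) ∩ objective P ⁻¹' Set.Iic c).eq_empty_or_nonempty with he | hne
  · refine ⟨1, one_pos, fun W hW => ?_⟩
    by_contra! hle
    exact (he ▸ (⟨hW, hle⟩ : W ∈ rateCouplings ρ P (D + 1) ∩ objective P ⁻¹' Set.Iic c) :
      W ∈ (∅ : Set (A × A → ℝ)))
  · obtain ⟨W₁, ⟨hW₁, hle₁⟩, hmin⟩ :=
      hK.exists_isMinOn hne (continuous_expDistortion ρ).continuousOn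
    have hlt : D < expDistortion ρ W₁ := by
      by_contra! hle
      have := concExponent_le_objective hPpos
        (⟨hW₁.1, hW₁.2.1, hle⟩ : W₁ ∈ rateCouplings ρ P D)
      exact absurd (hc.trans_le this) (not_lt.2 (EReal.coe_le_coe_iff.2 hle₁))
    have hle1 : expDistortion ρ W₁ ≤ D + 1 := hW₁.2.2
    refine ⟨(expDistortion ρ W₁ - D) / 2, by linarith, fun W hW => ?_⟩
    by_contra! hle
    have h1 : expDistortion ρ W₁ ≤ expDistortion ρ W :=
      hmin ⟨rateCouplings_mono (by linarith) hW, hle⟩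
    have h2 := hW.2.2
    linarith

end Exponent

/-! ### Product mass functions -/

section Product

variable {S : Type*} [Fintype S]

lemma sum_prod_eq_one {M : S → ℝ} (hM : ∑ s, M s = 1) (n : ℕ) :
    ∑ x : Fin n → S, ∏ i, M (x i) = 1 := by
  classical
  rw [← Fintype.piFinset_univ, ← Finset.prod_univ_sum]
  simp [hM]

lemma mass_nonneg {S : Type*} {M : S → ℝ} (hM : ∀ a, 0 ≤ M a) {n : ℕ} (C : Finset (Fin n → S)) :
    0 ≤ mass M C :=
  Finset.sum_nonneg fun _ _ => Finset.prod_nonneg fun _ _ => hM _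

lemma mass_pos {S : Type*} {M : S → ℝ} (hM : ∀ a, 0 < M a) {n : ℕ} {C : Finset (Fin n → S)}
    (hC : C.Nonempty) : 0 < mass M C :=
  Finset.sum_pos (fun _ _ => Finset.prod_pos fun _ _ => hM _) hC

lemma mass_univ {M : S → ℝ} (hM : ∑ s, M s = 1) (n : ℕ) :
    mass M (Finset.univ : Finset (Fin n → S)) = 1 :=
  sum_prod_eq_one hM n

/-- The law of a single coordinate under a product mass function. -/
lemma sum_prod_mul_apply {M : S → ℝ} (hM : ∑ s, M s = 1) {n : ℕ} (i : Fin n) (g : S → ℝ) :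
    ∑ x : Fin n → S, (∏ j, M (x j)) * g (x i) = ∑ a, M a * g a := by
  classical
  have h : ∀ x : Fin n → S, (∏ j, M (x j)) * g (x i) =
      ∏ j, (M (x j) * if j = i then g (x j) else 1) := fun x => by
    rw [Finset.prod_mul_distrib]
    simp
  simp only [h]
  rw [← Fintype.piFinset_univ, ← Finset.prod_univ_sum (fun _ => Finset.univ)
    (fun j a => M a * if j = i then g a else 1), Finset.prod_eq_single i]
  · simp
  · intro j _ hj
    simp [hj, hM]
  · simp

end Product

/-! ### Converse: the averaged coupling of a code -/

/-- The averaged coupling: the average over coordinates of the joint law of `(Xᵢ, f(X)ᵢ)` when `X`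
has the product law `Pⁿ`. -/
def averagedCoupling (P : A → ℝ) {n : ℕ} (f : (Fin n → A) → Fin n → A) (s : A × A) : ℝ :=
  open Classical in
  (1 / (n : ℝ)) * ∑ x : Fin n → A, (∏ j, P (x j)) * ∑ i, if (x i, f x i) = s then 1 else 0

lemma sum_averagedCoupling_mul (P : A → ℝ) {n : ℕ} (f : (Fin n → A) → Fin n → A)
    (g : A × A → ℝ) :
    ∑ s, averagedCoupling P f s * g s =
      (1 / (n : ℝ)) * ∑ x : Fin n → A, (∏ j, P (x j)) * ∑ i, g (x i, f x i) := by
  classical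
  simp only [averagedCoupling, mul_assoc, ← Finset.mul_sum, Finset.sum_mul]
  congr 1
  rw [Finset.sum_comm]
  refine Finset.sum_congr rfl fun x _ => ?_
  rw [← Finset.mul_sum, Finset.sum_comm]
  simp

section Coupling

variable {P : A → ℝ} {n : ℕ} {f : (Fin n → A) → Fin n → A}

lemma averagedCoupling_nonneg (hP : ∀ a, 0 ≤ P a) (s : A × A) : 0 ≤ averagedCoupling P f s := by
  unfold averagedCoupling
  refine mul_nonneg (by positivity) (Finset.sum_nonneg fun x _ =>
    mul_nonneg (Finset.prod_nonneg fun _ _ => hP _) (Finset.sum_nonneg fun i _ => ?_))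
  split_ifs <;> norm_num

/-- Pairs that occur have positive weight, so their log densities can be exponentiated back in the
converse. -/
lemma averagedCoupling_pos (hPpos : ∀ a, 0 < P a) (x : Fin n → A) (i : Fin n) :
    0 < averagedCoupling P f (x i, f x i) := by
  classical
  have hn : 0 < (n : ℝ) := by exact_mod_cast i.pos
  unfold averagedCoupling
  have h01 : ∀ (x' : Fin n → A) (j : Fin n),
      (0 : ℝ) ≤ if (x' j, f x' j) = (x i, f x i) then 1 else 0 := fun _ _ => by
    split_ifs <;> norm_num
  have hp : ∀ x' : Fin n → A, 0 < ∏ j, P (x' j) := fun x' => Finset.prod_pos fun _ _ => hPpos _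
  refine mul_pos (by positivity) (Finset.sum_pos'
    (fun x' _ => mul_nonneg (hp x').le (Finset.sum_nonneg fun j _ => ?_))
    ⟨x, Finset.mem_univ _, mul_pos (hp x) (Finset.sum_pos' (fun j _ => ?_)
      ⟨i, Finset.mem_univ _, by simp⟩)⟩)
  · convert h01 x' j
  · convert h01 x j

lemma averagedCoupling_fst (hP : ∑ a, P a = 1) (hn : 1 ≤ n) (x : A) :
    ∑ y, averagedCoupling P f (x, y) = P x := by
  classical
  have h := sum_averagedCoupling_mul P f (fun s => if s.1 = x then 1 else 0)
  have hn' : (n : ℝ) ≠ 0 := by positivity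
  simp only [Finset.mul_sum] at h
  rw [Finset.sum_comm] at h
  simp only [← Finset.mul_sum, sum_prod_mul_apply hP _ fun a => if a = x then (1 : ℝ) else 0,
    Fintype.sum_prod_type] at h
  simp only [mul_ite, mul_one, mul_zero, Finset.sum_ite_eq', Finset.mem_univ, if_true,
    Finset.sum_const, Finset.card_univ, Fintype.card_fin, nsmul_eq_mul] at h
  rw [Finset.sum_comm] at h
  simp only [Finset.sum_ite_eq', Finset.mem_univ, if_true] at h
  rw [h]
  field_simp

lemma expDistortion_averagedCoupling (ρ : A → A → ℝ) :
    expDistortion ρ (averagedCoupling P f) =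
      ∑ x : Fin n → A, (∏ j, P (x j)) * distortion ρ x (f x) := by
  rw [expDistortion_eq, sum_averagedCoupling_mul P f fun s => ρ s.1 s.2, Finset.mul_sum]
  refine Finset.sum_congr rfl fun x _ => ?_
  rw [distortion]
  ring

lemma averagedCoupling_mem (hP : P ∈ stdSimplex ℝ A) (hn : 1 ≤ n) :
    averagedCoupling P f ∈ stdSimplex ℝ (A × A) := by
  refine ⟨averagedCoupling_nonneg hP.1, ?_⟩
  simp only [Fintype.sum_prod_type, averagedCoupling_fst hP.2 hn, hP.2]

/-- The converse bound, by Jensen's inequality and the backward channel `W(x, y) / Q(y)` of the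
averaged coupling `W`. -/
lemma exp_objective_le_mass (hP : P ∈ stdSimplex ℝ A) (hPpos : ∀ a, 0 < P a) (hn : 1 ≤ n)
    {C : Finset (Fin n → A)} (hf : ∀ x, f x ∈ C) :
    Real.exp (n * objective P (averagedCoupling P f)) ≤ mass P C := by
  classical
  have hW : averagedCoupling P f ∈ stdSimplex ℝ (A × A) := averagedCoupling_mem hP hn
  have hWpos : ∀ (x : Fin n → A) i, 0 < averagedCoupling P f (x i, f x i) :=
    averagedCoupling_pos hPpos
  have havg := sum_averagedCoupling_mul P f
  generalize averagedCoupling P f = W at hW hWpos havg ⊢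
  have hQ : ∀ y, 0 ≤ sndMarginal W y := sndMarginal_nonneg hW.1
  have hQ1 : ∀ y, ∑ x, W (x, y) = sndMarginal W y := fun _ => rfl
  have hQpos : ∀ (x : Fin n → A) i, 0 < sndMarginal W (f x i) := fun x i =>
    (hWpos x i).trans_le (le_sndMarginal hW.1 (x i, f x i))
  have hobj0 : ∀ g : A × A → ℝ,
      g = (fun s => Real.log (W s / (P s.1 * sndMarginal W s.2)) + Real.log (P s.2)) →
      objective P W = ∑ s, W s * g s := by
    rintro g rfl
    simp only [objective, mutualInfo, mul_add, Finset.sum_add_distrib]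
    rw [sum_mul_snd W fun y => Real.log (P y)]
  generalize sndMarginal W = Q at hQ hQ1 hQpos hobj0
  have hn' : (n : ℝ) ≠ 0 := by positivity
  -- The objective is the `W`-mean of `g`, so `n` times it is a `Pⁿ`-mean of sums along words, ready
  -- for Jensen.
  let g : A × A → ℝ := fun s => Real.log (W s / (P s.1 * Q s.2)) + Real.log (P s.2)
  have hobj : n * objective P W = ∑ x : Fin n → A, (∏ j, P (x j)) * ∑ i, g (x i, f x i) := by
    rw [hobj0 g rfl, havg]
    field_simp
  have hexp : ∀ x : Fin n → A, (∏ j, P (x j)) * Real.exp (∑ i, g (x i, f x i)) =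
      (∏ i, P (f x i)) * ∏ i, (W (x i, f x i) / Q (f x i)) := fun x => by
    rw [Real.exp_sum, ← Finset.prod_mul_distrib, ← Finset.prod_mul_distrib]
    refine Finset.prod_congr rfl fun i _ => ?_
    have h1 := hPpos (x i)
    have h2 := hWpos x i
    have h3 := hQpos x i
    simp only [g]
    rw [Real.exp_add, Real.exp_log (hPpos _), Real.exp_log (by positivity)]
    field_simp
  -- Only an inequality: letters with `Q = 0` contribute `0 / 0 = 0`.
  have hker : ∀ y : Fin n → A, ∑ x : Fin n → A, ∏ i, (W (x i, y i) / Q (y i)) ≤ 1 := fun y => by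
    rw [← Fintype.piFinset_univ, ← Finset.prod_univ_sum (fun _ => Finset.univ)
      (fun i a => W (a, y i) / Q (y i))]
    refine Finset.prod_le_one (fun i _ => Finset.sum_nonneg fun a _ =>
      div_nonneg (hW.1 _) (hQ _)) fun i _ => ?_
    rw [← Finset.sum_div, hQ1]
    exact div_self_le_one _
  have hsum : ∑ x : Fin n → A, ∏ j, P (x j) = 1 := sum_prod_eq_one hP.2 n
  calc Real.exp (n * objective P W)
      ≤ ∑ x : Fin n → A, (∏ j, P (x j)) * Real.exp (∑ i, g (x i, f x i)) := by
        rw [hobj]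
        have := convexOn_exp.map_sum_le (t := Finset.univ) (w := fun x : Fin n → A => ∏ j, P (x j))
          (p := fun x => ∑ i, g (x i, f x i)) (fun x _ => Finset.prod_nonneg fun _ _ => hP.1 _)
          hsum (fun _ _ => Set.mem_univ _)
        simpa only [smul_eq_mul] using this
    _ = ∑ x : Fin n → A, (∏ i, P (f x i)) * ∏ i, (W (x i, f x i) / Q (f x i)) :=
        Finset.sum_congr rfl fun x _ => hexp x
    _ = ∑ y ∈ C, ∑ x ∈ Finset.univ.filter (fun x => f x = y),
          (∏ i, P (f x i)) * ∏ i, (W (x i, f x i) / Q (f x i)) :=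
        (Finset.sum_fiberwise_of_maps_to (fun x _ => hf x) _).symm
    _ ≤ ∑ y ∈ C, (∏ i, P (y i)) * 1 := by
        refine Finset.sum_le_sum fun y _ => ?_
        calc ∑ x ∈ Finset.univ.filter (fun x => f x = y),
              (∏ i, P (f x i)) * ∏ i, (W (x i, f x i) / Q (f x i))
            = ∑ x ∈ Finset.univ.filter (fun x => f x = y),
              (∏ i, P (y i)) * ∏ i, (W (x i, y i) / Q (y i)) := by
              refine Finset.sum_congr rfl fun x hx => ?_
              rw [(Finset.mem_filter.1 hx).2]
          _ ≤ ∑ x : Fin n → A, (∏ i, P (y i)) * ∏ i, (W (x i, y i) / Q (y i)) :=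
              Finset.sum_le_sum_of_subset_of_nonneg (Finset.filter_subset _ _)
                fun x _ _ => mul_nonneg (Finset.prod_nonneg fun _ _ => hP.1 _)
                  (Finset.prod_nonneg fun _ _ => div_nonneg (hW.1 _) (hQ _))
          _ ≤ _ := by
              rw [← Finset.mul_sum]
              exact mul_le_mul_of_nonneg_left (hker y) (Finset.prod_nonneg fun _ _ => hP.1 _)
    _ = mass P C := by simp [mass]

end Coupling

/-- Every nonempty code has a coupling whose expected distortion is the average distortion of the
code and whose objective is at most its normalised log-mass. -/
lemma exists_exp_objective_le_mass {P : A → ℝ} (hP : P ∈ stdSimplex ℝ A) (hPpos : ∀ a, 0 < P a)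
    (ρ : A → A → ℝ) {n : ℕ} (hn : 1 ≤ n) {C : Finset (Fin n → A)} (hC : C.Nonempty) :
    ∃ W ∈ rateCouplings ρ P (avgDistortion P ρ C hC),
      Real.exp (n * objective P W) ≤ mass P C := by
  have h : ∀ x, ∃ y ∈ C, distortionTo ρ C hC x = distortion ρ x y := fun x =>
    Finset.exists_mem_eq_inf' hC _
  choose f hf hfd using h
  refine ⟨averagedCoupling P f, ⟨averagedCoupling_mem hP hn, averagedCoupling_fst hP.2 hn, ?_⟩,
    exp_objective_le_mass hP hPpos hn hf⟩
  rw [expDistortion_averagedCoupling, avgDistortion]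
  simp only [hfd]
  exact le_rfl

/-! ### Chernoff bound -/

section LargeDeviation

variable {S : Type*} [Fintype S]

/-- The moment generating function equals one at zero and has negative derivative there. -/
lemma exists_expMoment_lt_one {M : S → ℝ} (hM : ∑ s, M s = 1) {f : S → ℝ}
    (hf : ∑ s, M s * f s < 0) : ∃ t > 0, ∑ s, M s * Real.exp (t * f s) < 1 := by
  have hd : HasDerivAt (fun t : ℝ => ∑ s, M s * Real.exp (t * f s)) (∑ s, M s * f s) 0 := by
    refine HasDerivAt.fun_sum fun s _ => ?_
    have h := (((hasDerivAt_id (0 : ℝ)).mul_const (f s)).exp).const_mul (M s)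
    simpa using h
  have h1 := (hasDerivAt_iff_tendsto_slope.1 hd).eventually_lt_const hf
  have h2 : ∀ᶠ t in 𝓝[>] (0 : ℝ), slope (fun t : ℝ => ∑ s, M s * Real.exp (t * f s)) 0 t < 0 :=
    h1.filter_mono (nhdsWithin_mono _ fun t ht => ne_of_gt ht)
  obtain ⟨t, ht, ht0⟩ := (h2.and self_mem_nhdsWithin).exists
  refine ⟨t, ht0, ?_⟩
  rw [slope_def_field, div_neg_iff] at ht
  have ht0' : (0 : ℝ) < t := ht0
  simp only [sub_zero, zero_mul, Real.exp_zero, mul_one, hM] at ht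
  rcases ht with ⟨-, h⟩ | ⟨h, -⟩ <;> linarith

open Classical in
/-- A one-sided weak law of large numbers for product mass functions, by Chernoff's bound. -/
lemma tendsto_mass_lt_sum {M : S → ℝ} (hM : M ∈ stdSimplex ℝ S) {f : S → ℝ} {c : ℝ}
    (hc : ∑ s, M s * f s < c) :
    Tendsto (fun n : ℕ => mass M (Finset.univ.filter fun s : Fin n → S => n * c < ∑ i, f (s i)))
      atTop (𝓝 0) := by
  have hneg : ∑ s, M s * (f s - c) < 0 := by
    simp only [mul_sub, Finset.sum_sub_distrib, ← Finset.sum_mul, hM.2]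
    linarith
  obtain ⟨t, ht, hlt⟩ := exists_expMoment_lt_one hM.2 hneg
  have hnn : ∀ s, 0 ≤ M s * Real.exp (t * (f s - c)) := fun s =>
    mul_nonneg (hM.1 s) (Real.exp_pos _).le
  refine squeeze_zero (fun n => mass_nonneg hM.1 _) (fun n => ?_)
    (tendsto_pow_atTop_nhds_zero_of_lt_one (Finset.sum_nonneg fun s _ => hnn s) hlt)
  rw [← Fin.prod_const, Finset.prod_univ_sum, Fintype.piFinset_univ]
  refine (Finset.sum_le_sum fun s hs => ?_).trans
    (Finset.sum_le_sum_of_subset_of_nonneg (Finset.filter_subset _ _)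
      fun s _ _ => Finset.prod_nonneg fun i _ => hnn (s i))
  rw [Finset.prod_mul_distrib, ← Real.exp_sum, ← Finset.mul_sum, Finset.sum_sub_distrib]
  refine le_mul_of_one_le_right (Finset.prod_nonneg fun _ _ => hM.1 _) (Real.one_le_exp ?_)
  have := (Finset.mem_filter.1 hs).2
  refine mul_nonneg ht.le ?_
  simpa using this.le

end LargeDeviation

/-! ### Greedy and one-shot covering -/

section Covering

variable {X Y : Type*} [Fintype X] [Fintype Y]

open Classical in
/-- Greedy covering: some set of at most `N` points covers at least as well as `N` independent
points with law `ν` do on average. -/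
lemma exists_card_le_sum_uncovered_le {ν : Y → ℝ} (hν : ν ∈ stdSimplex ℝ Y) (G : X → Y → Prop)
    (N : ℕ) (μ : X → ℝ) :
    ∃ C : Finset Y, C.card ≤ N ∧ ∑ x, (if ∃ y ∈ C, G x y then 0 else μ x) ≤
      ∑ x, μ x * (1 - ∑ y, if G x y then ν y else 0) ^ N := by
  induction N generalizing μ with
  | zero => exact ⟨∅, by simp⟩
  | succ N ih =>
    set q : X → ℝ := fun x => ∑ y, if G x y then ν y else 0 with hq
    -- `g y` is the inductive bound for what stays uncovered once `y` is chosen. Its `ν`-mean is the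
    -- bound for `N + 1` points, so a minimiser does at least as well.
    let g : Y → ℝ := fun y => ∑ x, (if G x y then 0 else μ x) * (1 - q x) ^ N
    have hY : (Finset.univ : Finset Y).Nonempty := by
      rw [Finset.nonempty_iff_ne_empty]
      intro h
      have := hν.2
      rw [h, Finset.sum_empty] at this
      exact zero_ne_one this
    have hg : ∑ y, ν y * g y = ∑ x, μ x * (1 - q x) ^ (N + 1) := by
      simp only [g, Finset.mul_sum]
      rw [Finset.sum_comm]
      refine Finset.sum_congr rfl fun x _ => ?_
      have h1 : 1 - q x = ∑ y, if G x y then 0 else ν y := by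
        rw [← hν.2, hq, ← Finset.sum_sub_distrib]
        refine Finset.sum_congr rfl fun y _ => ?_
        split_ifs <;> simp
      rw [pow_succ', ← mul_assoc]
      nth_rw 2 [h1]
      rw [Finset.mul_sum, Finset.sum_mul]
      refine Finset.sum_congr rfl fun y _ => ?_
      split_ifs
      · simp
      · ring
    obtain ⟨y, -, hy⟩ := Finset.exists_min_image Finset.univ g hY
    have hle : g y ≤ ∑ x, μ x * (1 - q x) ^ (N + 1) := by
      rw [← hg, ← one_mul (g y), ← hν.2, Finset.sum_mul]
      exact Finset.sum_le_sum fun z hz => mul_le_mul_of_nonneg_left (hy z hz) (hν.1 z)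
    obtain ⟨C, hcard, hC⟩ := ih fun x => if G x y then 0 else μ x
    refine ⟨insert y C, (Finset.card_insert_le _ _).trans (Nat.succ_le_succ hcard), ?_⟩
    refine le_trans (le_of_eq ?_) (hC.trans hle)
    refine Finset.sum_congr rfl fun x _ => ?_
    by_cases h1 : G x y <;> by_cases h2 : ∃ z ∈ C, G x z <;> simp [h1, h2]

open Classical in
/-- One-shot covering: if the density of `w` with respect to the product of its first marginal and
`ν` is at most `M` on `G`, then a set of at most `N` points covers, in the sense of `G`, all but
`2 w(Gᶜ) + exp(-N / 2M)` of the first marginal. -/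
lemma exists_card_le_sum_uncovered_le_exp {w : X → Y → ℝ} (hw : ∀ x y, 0 ≤ w x y)
    (hw1 : ∑ x, ∑ y, w x y = 1) {ν : Y → ℝ} (hν : ν ∈ stdSimplex ℝ Y) {G : X → Y → Prop} {M : ℝ}
    (hM : 0 < M) (hG : ∀ x y, G x y → w x y ≤ M * (∑ z, w x z) * ν y) (N : ℕ) :
    ∃ C : Finset Y, C.card ≤ N ∧
      ∑ x, (if ∃ y ∈ C, G x y then 0 else ∑ y, w x y) ≤
        2 * ∑ x, ∑ y, (if G x y then 0 else w x y) + Real.exp (-(N / (2 * M))) := by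
  obtain ⟨C, hcard, hC⟩ := exists_card_le_sum_uncovered_le hν G N fun x => ∑ y, w x y
  refine ⟨C, hcard, hC.trans ?_⟩
  have hsum : Real.exp (-(N / (2 * M))) = ∑ x, (∑ y, w x y) * Real.exp (-(N / (2 * M))) := by
    rw [← Finset.sum_mul, hw1, one_mul]
  rw [hsum, Finset.mul_sum, ← Finset.sum_add_distrib]
  refine Finset.sum_le_sum fun x _ => ?_
  set m := ∑ y, w x y with hm
  set q := ∑ y, if G x y then ν y else 0 with hq
  set b := ∑ y, if G x y then 0 else w x y with hb
  have hm0 : 0 ≤ m := Finset.sum_nonneg fun y _ => hw x y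
  have hb0 : 0 ≤ b := Finset.sum_nonneg fun y _ => by
    split_ifs
    exacts [le_rfl, hw x y]
  have hq0 : 0 ≤ q := Finset.sum_nonneg fun y _ => by
    split_ifs
    exacts [hν.1 y, le_rfl]
  have hq1 : q ≤ 1 := by
    rw [← hν.2]
    refine Finset.sum_le_sum fun y _ => ?_
    split_ifs
    exacts [le_rfl, hν.1 y]
  have hmq : m ≤ b + M * m * q := by
    rw [hb, hq, Finset.mul_sum, ← Finset.sum_add_distrib]
    nth_rw 1 [hm]
    refine Finset.sum_le_sum fun y _ => ?_
    split_ifs with h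
    · simpa using hG x y h
    · simp
  have hexp : 0 < Real.exp (-(N / (2 * M))) := Real.exp_pos _
  -- If more than half of the mass at `x` is bad, `2 * b` pays for all of it. Otherwise `M * m * q ≥
  -- m / 2`, so `q ≥ 1 / (2 * M)` unless `m = 0`.
  rcases lt_or_ge m (2 * b) with h | h
  · have : (1 - q) ^ N ≤ 1 := pow_le_one₀ (by linarith) (by linarith)
    have h1 := mul_le_mul_of_nonneg_left this hm0
    have h2 := mul_nonneg hm0 hexp.le
    linarith
  · have key : m * (1 - q) ^ N ≤ m * Real.exp (-(N / (2 * M))) := by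
      rcases hm0.eq_or_lt with h0 | h0
      · simp [← h0]
      refine mul_le_mul_of_nonneg_left ?_ hm0
      have hq' : 1 / (2 * M) ≤ q := by
        rw [div_le_iff₀ (by positivity)]
        have : m * 1 ≤ m * (q * (2 * M)) := by nlinarith
        exact le_of_mul_le_mul_left this h0
      calc (1 - q) ^ N ≤ (Real.exp (-(1 / (2 * M)))) ^ N := by
            refine pow_le_pow_left₀ (by linarith) ?_ N
            have := Real.add_one_le_exp (-(1 / (2 * M)))
            linarith
        _ = _ := by
            rw [← Real.exp_nat_mul]
            congr 1
            ring
    linarith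

end Covering

/-! ### Achievability: codes from typical words -/

section Achievability

lemma sum_fun_prod {n : ℕ} (F : (Fin n → A) → (Fin n → A) → ℝ) :
    ∑ x, ∑ y, F x y = ∑ s : Fin n → A × A, F (fun i => (s i).1) (fun i => (s i).2) := by
  rw [← Fintype.sum_prod_type']
  exact ((Equiv.arrowProdEquivProdArrow (Fin n) (fun _ => A) (fun _ => A)).sum_comp
    fun p => F p.1 p.2).symm

lemma sum_prod_pair {W : A × A → ℝ} {P : A → ℝ} (hW : ∀ x, ∑ y, W (x, y) = P x) {n : ℕ}
    (x : Fin n → A) : ∑ y : Fin n → A, ∏ i, W (x i, y i) = ∏ i, P (x i) := by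
  classical
  rw [← Fintype.piFinset_univ, ← Finset.prod_univ_sum (fun _ => Finset.univ)
      (fun i a => W (x i, a))]
  simp only [hW]

open Classical in
lemma mass_blowup_eq {P : A → ℝ} (hP : ∑ a, P a = 1) (ρ : A → A → ℝ) (D : ℝ) {n : ℕ}
    (C : Finset (Fin n → A)) :
    mass P (blowup ρ D C) =
      1 - ∑ x : Fin n → A, if ∃ y ∈ C, distortion ρ x y ≤ D then 0 else ∏ i, P (x i) := by
  rw [← sum_prod_eq_one hP n, ← Finset.sum_sub_distrib, mass, blowup, Finset.sum_filter]
  refine Finset.sum_congr rfl fun x _ => ?_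
  split_ifs <;> simp

omit [Fintype A] in
lemma distortion_le_iff (ρ : A → A → ℝ) {D : ℝ} {n : ℕ} (hn : 1 ≤ n) (x y : Fin n → A) :
    distortion ρ x y ≤ D ↔ ∑ i, ρ (x i) (y i) ≤ n * D := by
  have : 0 < (n : ℝ) := by positivity
  rw [distortion, one_div, inv_mul_le_iff₀ this]

variable {P : A → ℝ} {ρ : A → A → ℝ} {D : ℝ} {W : A × A → ℝ}

lemma prod_le_exp_mul (hPpos : ∀ a, 0 < P a) (hW : ∀ s, 0 ≤ W s) {n : ℕ} {c : ℝ}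
    {x y : Fin n → A}
    (h : ∑ i, Real.log (W (x i, y i) / (P (x i) * sndMarginal W (y i))) ≤ c) :
    ∏ i, W (x i, y i) ≤ Real.exp c * (∏ i, P (x i)) * ∏ i, sndMarginal W (y i) := by
  have hQ := sndMarginal_nonneg hW
  have hR : 0 ≤ (∏ i, P (x i)) * ∏ i, sndMarginal W (y i) :=
    mul_nonneg (Finset.prod_nonneg fun _ _ => (hPpos _).le) (Finset.prod_nonneg fun _ _ => hQ _)
  by_cases h0 : ∀ i, 0 < W (x i, y i)
  · have hQ' : ∀ i, 0 < sndMarginal W (y i) := fun i =>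
      (h0 i).trans_le (le_sndMarginal hW (x i, y i))
    calc ∏ i, W (x i, y i)
        = Real.exp (∑ i, Real.log (W (x i, y i) / (P (x i) * sndMarginal W (y i)))) *
          ((∏ i, P (x i)) * ∏ i, sndMarginal W (y i)) := by
          rw [Real.exp_sum, ← Finset.prod_mul_distrib, ← Finset.prod_mul_distrib]
          refine Finset.prod_congr rfl fun i _ => ?_
          have h1 := hPpos (x i)
          have h2 := h0 i
          have h3 := hQ' i
          rw [Real.exp_log (by positivity)]
          field_simp
      _ ≤ _ := by
          rw [mul_assoc]
          exact mul_le_mul_of_nonneg_right (Real.exp_le_exp.2 h) hR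
  · push Not at h0
    obtain ⟨i, hi⟩ := h0
    rw [Finset.prod_eq_zero (Finset.mem_univ i) (le_antisymm hi (hW _)), mul_assoc]
    exact mul_nonneg (Real.exp_pos _).le hR

omit [Fintype A] in
lemma mass_filter_le_card_mul_exp (hPpos : ∀ a, 0 < P a) {n : ℕ} {c : ℝ}
    {C : Finset (Fin n → A)} (hC : ∀ y ∈ C, ∑ i, Real.log (P (y i)) ≤ c) :
    mass P C ≤ C.card * Real.exp c := by
  rw [← nsmul_eq_mul]
  refine Finset.sum_le_card_nsmul _ _ _ fun y hy => ?_
  calc ∏ i, P (y i) = Real.exp (∑ i, Real.log (P (y i))) := by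
        rw [Real.exp_sum]
        exact Finset.prod_congr rfl fun i _ => (Real.exp_log (hPpos _)).symm
    _ ≤ _ := Real.exp_le_exp.2 (hC y hy)

open Classical in
/-- Achievability: codes drawn from the second marginal of `W` cover most of `Aⁿ`, provided that
the distortion constraint holds with high probability under `Wⁿ`. -/
lemma eventually_exists_code (hP : P ∈ stdSimplex ℝ A) (hPpos : ∀ a, 0 < P a)
    (hW : W ∈ stdSimplex ℝ (A × A)) (hW1 : ∀ x, ∑ y, W (x, y) = P x)
    (hdist : Tendsto (fun n : ℕ => mass W
      (Finset.univ.filter fun s : Fin n → A × A => n * D < ∑ i, ρ (s i).1 (s i).2)) atTop (𝓝 0))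
    {δ ε : ℝ} (hδ : 0 < δ) (hε : 0 < ε) :
    ∀ᶠ n : ℕ in atTop, ∃ C : Finset (Fin n → A), 1 - ε ≤ mass P (blowup ρ D C) ∧
      mass P C ≤ Real.exp (n * (objective P W + δ)) := by
  -- One `d` each for the deviation of the information density, the surplus of codewords, the
  -- rounding up of their number, and the deviation of `log P`.
  obtain ⟨d, hd, rfl⟩ : ∃ d > 0, δ = 4 * d := ⟨δ / 4, by positivity, by ring⟩
  set I := mutualInfo P W with hI
  set E := ∑ y, sndMarginal W y * Real.log (P y) with hE
  have hI0 : 0 ≤ I := mutualInfo_nonneg hP hPpos hW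
  let i₀ : A × A → ℝ := fun s => Real.log (W s / (P s.1 * sndMarginal W s.2))
  have hTI := tendsto_mass_lt_sum hW (f := i₀) (c := I + d) (by
    change mutualInfo P W < I + d
    linarith)
  have hTE := tendsto_mass_lt_sum hW (f := fun s => Real.log (P s.2)) (c := E + d) (by
    rw [sum_mul_snd W fun y => Real.log (P y)]
    linarith)
  have hexp : Tendsto (fun n : ℕ => Real.exp (-(Real.exp (n * d) / 2))) atTop (𝓝 0) := by
    refine Real.tendsto_exp_neg_atTop_nhds_zero.comp ?_
    refine Tendsto.atTop_div_const two_pos (Real.tendsto_exp_atTop.comp ?_)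
    exact tendsto_natCast_atTop_atTop.atTop_mul_const hd
  have htot := ((((hdist.add hTI).add hTE).const_mul 2).add hexp)
  simp only [add_zero, mul_zero] at htot
  have hlog : ∀ᶠ n : ℕ in atTop, Real.log 2 ≤ n * d :=
    (tendsto_natCast_atTop_atTop.atTop_mul_const hd).eventually_ge_atTop _
  filter_upwards [htot.eventually_le_const hε, hlog, eventually_ge_atTop 1] with n hn hlogn hn1
  obtain ⟨G, hGdef⟩ : ∃ G : (Fin n → A) → (Fin n → A) → Prop, ∀ x y, G x y ↔
      ∑ i, ρ (x i) (y i) ≤ n * D ∧ ∑ i, i₀ (x i, y i) ≤ n * (I + d) ∧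
        ∑ i, Real.log (P (y i)) ≤ n * (E + d) :=
    ⟨_, fun _ _ => Iff.rfl⟩
  let w : (Fin n → A) → (Fin n → A) → ℝ := fun x y => ∏ i, W (x i, y i)
  have hw0 : ∀ x y, 0 ≤ w x y := fun x y => Finset.prod_nonneg fun _ _ => hW.1 _
  have hwx : ∀ x, ∑ y, w x y = ∏ i, P (x i) := sum_prod_pair hW1
  have hw1 : ∑ x, ∑ y, w x y = 1 := by
    simp only [hwx]
    exact sum_prod_eq_one hP.2 n
  have hν : (fun y : Fin n → A => ∏ i, sndMarginal W (y i)) ∈ stdSimplex ℝ (Fin n → A) :=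
    ⟨fun y => Finset.prod_nonneg fun _ _ => sndMarginal_nonneg hW.1 _,
      sum_prod_eq_one (sndMarginal_mem hW).2 n⟩
  have hbad : ∑ x, ∑ y, (if G x y then 0 else w x y) ≤
      mass W (Finset.univ.filter fun s : Fin n → A × A => n * D < ∑ i, ρ (s i).1 (s i).2) +
      mass W (Finset.univ.filter fun s : Fin n → A × A => n * (I + d) < ∑ i, i₀ (s i)) +
      mass W (Finset.univ.filter fun s : Fin n → A × A =>
        n * (E + d) < ∑ i, Real.log (P (s i).2)) := by
    rw [sum_fun_prod fun x y => if G x y then 0 else w x y]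
    simp only [mass, Finset.sum_filter]
    rw [← Finset.sum_add_distrib, ← Finset.sum_add_distrib]
    refine Finset.sum_le_sum fun s _ => ?_
    have hs : 0 ≤ ∏ i, W (s i) := Finset.prod_nonneg fun _ _ => hW.1 _
    by_cases hG : G (fun i => (s i).1) fun i => (s i).2
    · rw [if_pos hG]
      split_ifs <;> linarith
    · rw [if_neg hG]
      rw [hGdef, not_and_or, not_and_or, not_le, not_le, not_le] at hG
      change ∏ i, W (s i) ≤ _
      rcases hG with h | h | h
      · rw [if_pos h]
        split_ifs <;> linarith
      · rw [if_pos (c := n * (I + d) < ∑ i, i₀ (s i)) h]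
        split_ifs <;> linarith
      · rw [if_pos h]
        split_ifs <;> linarith
  obtain ⟨C, hcard, hC⟩ := exists_card_le_sum_uncovered_le_exp hw0 hw1 hν (G := G)
    (M := Real.exp (n * (I + d))) (Real.exp_pos _)
    (fun x y hG => by
      rw [hwx]
      exact prod_le_exp_mul hPpos hW.1 ((hGdef x y).1 hG).2.1) ⌈Real.exp (n * (I + 2 * d))⌉₊
  set N := ⌈Real.exp (n * (I + 2 * d))⌉₊ with hN
  have hNge : Real.exp (n * (I + 2 * d)) ≤ N := Nat.le_ceil _
  have hNle : (N : ℝ) ≤ Real.exp (n * (I + 3 * d)) := by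
    have h1 : (1 : ℝ) ≤ Real.exp (n * (I + 2 * d)) := Real.one_le_exp (by positivity)
    have h2 := (Nat.ceil_lt_add_one (Real.exp_pos (n * (I + 2 * d))).le).le
    calc (N : ℝ) ≤ 2 * Real.exp (n * (I + 2 * d)) := by linarith
      _ ≤ Real.exp (n * d) * Real.exp (n * (I + 2 * d)) := by
          refine mul_le_mul_of_nonneg_right ?_ (Real.exp_pos _).le
          rwa [← Real.log_le_iff_le_exp two_pos]
      _ = _ := by
          rw [← Real.exp_add]
          congr 1
          ring
  -- `N` exceeds the density bound by a factor `exp (n * d)`, so the uncovered remainder is doubly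
  -- exponentially small.
  have hNexp : Real.exp (-(N / (2 * Real.exp (n * (I + d))))) ≤
      Real.exp (-(Real.exp (n * d) / 2)) := by
    refine Real.exp_le_exp.2 (neg_le_neg ?_)
    rw [div_le_div_iff₀ two_pos (by positivity)]
    have : Real.exp (n * d) * Real.exp (n * (I + d)) = Real.exp (n * (I + 2 * d)) := by
      rw [← Real.exp_add]
      congr 1
      ring
    linarith
  -- Discarding heavy codewords loses no `G`-coverage, since `G` already demands this bound on `y`.
  refine ⟨C.filter fun y => ∑ i, Real.log (P (y i)) ≤ n * (E + d), ?_, ?_⟩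
  · rw [mass_blowup_eq hP.2]
    refine sub_le_sub_left (le_trans (Finset.sum_le_sum fun x _ => ?_)
      (hC.trans (by linarith))) 1
    rw [hwx]
    have hx : 0 ≤ ∏ i, P (x i) := Finset.prod_nonneg fun _ _ => hP.1 _
    by_cases h : ∃ y ∈ C, G x y
    · obtain ⟨y, hy, hG⟩ := h
      rw [hGdef] at hG
      rw [if_pos ⟨y, Finset.mem_filter.2 ⟨hy, hG.2.2⟩, (distortion_le_iff ρ hn1 x y).2 hG.1⟩]
      split_ifs <;> simp [hx]
    · rw [if_neg h]
      split_ifs <;> simp [hx]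
  · refine (mass_filter_le_card_mul_exp hPpos fun y hy => (Finset.mem_filter.1 hy).2).trans ?_
    calc _ ≤ Real.exp (n * (I + 3 * d)) * Real.exp (n * (E + d)) := by
          refine mul_le_mul_of_nonneg_right (le_trans ?_ hNle) (Real.exp_pos _).le
          exact_mod_cast (Finset.card_filter_le _ _).trans hcard
      _ = _ := by
          rw [← Real.exp_add, objective]
          congr 1
          ring

end Achievability

/-! ### The three assertions -/

variable {P : A → ℝ} {ρ : A → A → ℝ} {D : ℝ}

lemma exp_mul_concExponent_le_mass (hP : P ∈ stdSimplex ℝ A) (hPpos : ∀ a, 0 < P a) {n : ℕ}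
    (hn : 1 ≤ n) {C : Finset (Fin n → A)} (hC : C.Nonempty) :
    EReal.exp ((n : EReal) * concExponent ρ P (avgDistortion P ρ C hC)) ≤
      ENNReal.ofReal (mass P C) := by
  obtain ⟨W, hW, hle⟩ := exists_exp_objective_le_mass hP hPpos ρ hn hC
  calc EReal.exp ((n : EReal) * concExponent ρ P (avgDistortion P ρ C hC))
      ≤ EReal.exp (((n * objective P W : ℝ)) : EReal) := by
        refine EReal.exp_monotone ?_
        rw [EReal.coe_mul]
        exact mul_le_mul_of_nonneg_left (concExponent_le_objective hPpos hW) (by positivity)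
    _ = ENNReal.ofReal (Real.exp (n * objective P W)) := EReal.exp_coe _
    _ ≤ _ := ENNReal.ofReal_le_ofReal hle

lemma exists_distortion_bound (hρ : ∀ a b, 0 ≤ ρ a b) : ∃ B, ∀ a b, ρ a b ≤ B :=
  ⟨∑ a, ∑ b, ρ a b, fun a b =>
    (Finset.single_le_sum (f := fun b => ρ a b) (fun _ _ => hρ _ _) (Finset.mem_univ b)).trans
      (Finset.single_le_sum (f := fun a => ∑ b, ρ a b)
        (fun _ _ => Finset.sum_nonneg fun _ _ => hρ _ _) (Finset.mem_univ a))⟩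

/-- Words in the blowup cost at most `D`, all others at most `B`. -/
lemma avgDistortion_le (hP : P ∈ stdSimplex ℝ A) (hD : 0 ≤ D) {B : ℝ}
    (hB : ∀ a b, ρ a b ≤ B) {n : ℕ} (hn : 1 ≤ n) {C : Finset (Fin n → A)} (hC : C.Nonempty) :
    avgDistortion P ρ C hC ≤ D + B * (1 - mass P (blowup ρ D C)) := by
  classical
  rw [mass_blowup_eq hP.2, sub_sub_cancel]
  refine le_of_le_of_eq (Finset.sum_le_sum fun x _ => ?_) (show
    (∑ x : Fin n → A, (D * ∏ i, P (x i) +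
      B * if ∃ y ∈ C, distortion ρ x y ≤ D then 0 else ∏ i, P (x i))) = _ by
    rw [Finset.sum_add_distrib, ← Finset.mul_sum, ← Finset.mul_sum, sum_prod_eq_one hP.2 n,
      mul_one])
  have hx : 0 ≤ ∏ i, P (x i) := Finset.prod_nonneg fun _ _ => hP.1 _
  split_ifs with h
  · obtain ⟨y, hy, hyD⟩ := h
    have : distortionTo ρ C hC x ≤ D := (Finset.inf'_le _ hy).trans hyD
    have := mul_le_mul_of_nonneg_left this hx
    linarith
  · obtain ⟨y, hy⟩ := hC
    have h1 : distortion ρ x y ≤ B := by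
      rw [distortion_le_iff ρ hn]
      refine (Finset.sum_le_sum fun i _ => hB _ _).trans ?_
      simp
    have : distortionTo ρ C ⟨y, hy⟩ x ≤ B := (Finset.inf'_le _ hy).trans h1
    have h2 := mul_le_mul_of_nonneg_left this hx
    have h3 := mul_nonneg hD hx
    linarith

lemma nonempty_of_mass_blowup_pos {n : ℕ} {C : Finset (Fin n → A)}
    (h : 0 < mass P (blowup ρ D C)) : C.Nonempty := by
  rw [Finset.nonempty_iff_ne_empty]
  rintro rfl
  simp [blowup, mass] at h

lemma concExponent_le_liminf (hP : P ∈ stdSimplex ℝ A) (hPpos : ∀ a, 0 < P a)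
    (hρ : ∀ a b, 0 ≤ ρ a b) (hD : 0 ≤ D) {C : (n : ℕ) → Finset (Fin n → A)}
    (hC : Tendsto (fun n => mass P (blowup ρ D (C n))) atTop (𝓝 1)) :
    concExponent ρ P D ≤ liminf (fun n : ℕ =>
      (((1 / (n : ℝ)) * Real.log (mass P (C n)) : ℝ) : EReal)) atTop := by
  refine le_of_forall_lt fun c hc => ?_
  obtain ⟨c', hcc', hc'⟩ := EReal.lt_iff_exists_real_btwn.1 hc
  refine hcc'.trans_le (le_liminf_of_le (by isBoundedDefault) ?_)
  obtain ⟨ε, hε, hlt⟩ := exists_pos_forall_lt_objective hPpos hc'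
  obtain ⟨B, hB⟩ := exists_distortion_bound hρ
  have hlim : Tendsto (fun n => B * (1 - mass P (blowup ρ D (C n)))) atTop (𝓝 0) := by
    simpa using (hC.const_sub 1).const_mul B
  filter_upwards [hlim.eventually_le_const hε, hC.eventually_const_lt one_pos,
    eventually_ge_atTop 1] with n hn hpos hn1
  have hne := nonempty_of_mass_blowup_pos hpos
  obtain ⟨W, hW, hle⟩ := exists_exp_objective_le_mass hP hPpos ρ hn1 hne
  have h1 := hlt W (rateCouplings_mono
    ((avgDistortion_le hP hD hB hn1 hne).trans (by linarith)) hW)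
  rw [EReal.coe_le_coe_iff, one_div, ← div_eq_inv_mul, le_div_iff₀ (by positivity),
    Real.le_log_iff_exp_le (mass_pos hPpos hne)]
  refine le_trans (Real.exp_le_exp.2 ?_) hle
  rw [mul_comm]
  exact mul_le_mul_of_nonneg_left h1.le (by positivity)

open Classical in
/-- Near-optimal couplings can be chosen so that the distortion constraint holds with high
probability. -/
lemma exists_coupling_tendsto (hP : P ∈ stdSimplex ℝ A) (hPpos : ∀ a, 0 < P a)
    (hρ : ∀ a b, 0 ≤ ρ a b) (hρ0 : ∀ a, ∃ b, ρ a b = 0) (hD : 0 ≤ D) {V : A × A → ℝ}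
    (hV : V ∈ rateCouplings ρ P D) {δ : ℝ} (hδ : 0 < δ) :
    ∃ W ∈ rateCouplings ρ P D, objective P W ≤ objective P V + δ ∧
      Tendsto (fun n : ℕ => mass W
        (Finset.univ.filter fun s : Fin n → A × A => n * D < ∑ i, ρ (s i).1 (s i).2))
        atTop (𝓝 0) := by
  -- For `D = 0` no slack is possible, but `ρ` vanishes on the support of `V`, so the bad event is
  -- null. For `D > 0`, a small admixture of a zero-distortion coupling makes the constraint strict
  -- and moves the objective little.
  rcases hD.eq_or_lt with rfl | hDpos
  · refine ⟨V, hV, by linarith, ?_⟩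
    have hzero : ∀ s, V s * ρ s.1 s.2 = 0 := by
      have h0 : ∀ s ∈ Finset.univ, 0 ≤ V s * ρ s.1 s.2 := fun s _ =>
        mul_nonneg (hV.1.1 s) (hρ _ _)
      have h1 : ∑ s, V s * ρ s.1 s.2 = 0 := le_antisymm
        (by rw [← expDistortion_eq]; exact hV.2.2) (Finset.sum_nonneg h0)
      exact fun s => (Finset.sum_eq_zero_iff_of_nonneg h0).1 h1 s (Finset.mem_univ s)
    refine tendsto_const_nhds.congr fun n => (Finset.sum_eq_zero fun s hs => ?_).symm
    have hs' := (Finset.mem_filter.1 hs).2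
    rw [mul_zero] at hs'
    obtain ⟨i, -, hi⟩ := Finset.exists_lt_of_sum_lt (s := Finset.univ) (f := fun _ => (0 : ℝ))
      (by simpa using hs')
    exact Finset.prod_eq_zero (Finset.mem_univ i)
      ((mul_eq_zero.1 (hzero (s i))).resolve_right hi.ne')
  · obtain ⟨U, hU, hU0⟩ := exists_rateCouplings_zero hP hρ0
    let γ : ℝ → A × A → ℝ := fun t s => (1 - t) * V s + t * U s
    have hγd : ∀ t, expDistortion ρ (γ t) = (1 - t) * expDistortion ρ V := fun t => by
      have : expDistortion ρ (γ t) = (1 - t) * expDistortion ρ V + t * expDistortion ρ U := by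
        simp only [expDistortion_eq, γ, add_mul, Finset.sum_add_distrib, Finset.mul_sum, mul_assoc]
      rw [this, hU0, mul_zero, add_zero]
    have hVd := hV.2.2
    have hγm : ∀ t ∈ Set.Icc (0 : ℝ) 1, γ t ∈ rateCouplings ρ P D := fun t ht => by
      refine ⟨⟨fun s => add_nonneg (mul_nonneg (sub_nonneg.2 ht.2) (hV.1.1 s))
        (mul_nonneg ht.1 (hU.1.1 s)), ?_⟩, fun x => ?_, ?_⟩
      · simp only [γ, Finset.sum_add_distrib, ← Finset.mul_sum, hV.1.2, hU.1.2]
        ring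
      · simp only [γ, Finset.sum_add_distrib, ← Finset.mul_sum, hV.2.1, hU.2.1]
        ring
      · rw [hγd]
        nlinarith [ht.1, ht.2]
    have hγc : Continuous γ := by fun_prop
    have hγ0 : γ 0 = V := by ext s; simp [γ]
    have hcont : ContinuousWithinAt (fun t => objective P (γ t)) (Set.Icc 0 1) 0 :=
      ((continuousOn_objective (ρ := ρ) (D := D) hPpos).comp hγc.continuousOn hγm) 0
        (by simp)
    have hev : ∀ᶠ t in 𝓝[Set.Ioc 0 1] (0 : ℝ), objective P (γ t) < objective P V + δ :=
      (hcont.tendsto.eventually_lt_const (by rw [hγ0]; linarith)).filter_mono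
        (nhdsWithin_mono _ Set.Ioc_subset_Icc_self)
    have hne : (𝓝[Set.Ioc 0 1] (0 : ℝ)).NeBot := by
      rw [nhdsWithin_Ioc_eq_nhdsGT one_pos]
      infer_instance
    obtain ⟨t, ht, htm⟩ := (hev.and self_mem_nhdsWithin).exists
    have hm := hγm t (Set.Ioc_subset_Icc_self htm)
    refine ⟨γ t, hm, ht.le, tendsto_mass_lt_sum hm.1 (f := fun s => ρ s.1 s.2) ?_⟩
    rw [← expDistortion_eq, hγd]
    nlinarith [htm.1, htm.2]

/-- Diagonal extraction from countably many eventual properties. -/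
lemma exists_seq_tendsto_of_eventually {p : ℕ → ℕ → Prop}
    (h : ∀ k, ∀ᶠ n in atTop, p k n) :
    ∃ K : ℕ → ℕ, Tendsto K atTop atTop ∧ ∀ᶠ n in atTop, p (K n) n := by
  classical
  -- `Nat.findGreatest` falls back to `0`, so the second claim needs `p 0 n`, which holds
  -- eventually.
  refine ⟨fun n => Nat.findGreatest (fun k => p k n) n, tendsto_atTop.2 fun k => ?_, ?_⟩
  · filter_upwards [h k, eventually_ge_atTop k] with n hn hkn
    exact Nat.le_findGreatest hkn hn
  · filter_upwards [h 0] with n hn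
    exact Nat.findGreatest_spec (P := fun k => p k n) (Nat.zero_le n) hn

lemma exists_seq_tendsto_concExponent (hP : P ∈ stdSimplex ℝ A) (hPpos : ∀ a, 0 < P a)
    (hρ : ∀ a b, 0 ≤ ρ a b) (hρ0 : ∀ a, ∃ b, ρ a b = 0) (hD : 0 ≤ D) :
    ∃ C : (n : ℕ) → Finset (Fin n → A),
      Tendsto (fun n => mass P (blowup ρ D (C n))) atTop (𝓝 1) ∧
      Tendsto (fun n : ℕ => (((1 / (n : ℝ)) * Real.log (mass P (C n)) : ℝ) : EReal)) atTop
        (𝓝 (concExponent ρ P D)) := by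
  classical
  obtain ⟨V, hV, hVeq⟩ := exists_concExponent_eq hP hPpos hρ0 hD
  set R := objective P V with hR
  let u : ℕ → ℝ := fun k => 1 / ((k : ℝ) + 1)
  have hu : Tendsto u atTop (𝓝 0) := tendsto_one_div_add_atTop_nhds_zero_nat
  have hu0 : ∀ k, 0 < u k := fun k => by positivity
  obtain ⟨K, hK, hev⟩ := exists_seq_tendsto_of_eventually
    (p := fun k n => ∃ C : Finset (Fin n → A), 1 - u k ≤ mass P (blowup ρ D C) ∧
      mass P C ≤ Real.exp (n * (R + 2 * u k))) fun k => by
    obtain ⟨W, hW, hWV, hlim⟩ := exists_coupling_tendsto hP hPpos hρ hρ0 hD hV (hu0 k)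
    filter_upwards [eventually_exists_code hP hPpos hW.1 hW.2.1 hlim (hu0 k) (hu0 k)] with n hn
    obtain ⟨C, h1, h2⟩ := hn
    refine ⟨C, h1, h2.trans (Real.exp_le_exp.2 ?_)⟩
    exact mul_le_mul_of_nonneg_left (by linarith) (by positivity)
  let C : (n : ℕ) → Finset (Fin n → A) := fun n =>
    if h : ∃ C : Finset (Fin n → A), 1 - u (K n) ≤ mass P (blowup ρ D C) ∧
      mass P C ≤ Real.exp (n * (R + 2 * u (K n))) then h.choose else ∅
  have hC : ∀ᶠ n in atTop, 1 - u (K n) ≤ mass P (blowup ρ D (C n)) ∧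
      mass P (C n) ≤ Real.exp (n * (R + 2 * u (K n))) := by
    filter_upwards [hev] with n hn
    simp only [C, dif_pos hn]
    exact hn.choose_spec
  have huK : Tendsto (fun n => u (K n)) atTop (𝓝 0) := hu.comp hK
  have hblow : Tendsto (fun n => mass P (blowup ρ D (C n))) atTop (𝓝 1) := by
    refine tendsto_of_tendsto_of_tendsto_of_le_of_le' (g := fun n => 1 - u (K n))
      (by simpa using huK.const_sub 1) tendsto_const_nhds (hC.mono fun n hn => hn.1)
      (Eventually.of_forall fun n => ?_)
    rw [← mass_univ hP.2 n]
    exact Finset.sum_le_sum_of_subset_of_nonneg (Finset.subset_univ _)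
      fun _ _ _ => Finset.prod_nonneg fun _ _ => hP.1 _
  -- The converse applied to these very codes gives the lower half of the limit.
  refine ⟨C, hblow, tendsto_of_le_liminf_of_limsup_le
    (concExponent_le_liminf hP hPpos hρ hD hblow) ?_⟩
  have hup : Tendsto (fun n => ((R + 2 * u (K n) : ℝ) : EReal)) atTop (𝓝 (R : EReal)) := by
    refine (continuous_coe_real_ereal.tendsto R).comp ?_
    simpa using (huK.const_mul 2).const_add R
  rw [hVeq, ← hup.limsup_eq]
  refine limsup_le_limsup ?_
  filter_upwards [hC, hblow.eventually_const_lt one_pos, eventually_ge_atTop 1] with n hn hpos hn1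
  rw [EReal.coe_le_coe_iff, one_div, ← div_eq_inv_mul, div_le_iff₀ (by positivity),
    Real.log_le_iff_le_exp (mass_pos hPpos (nonempty_of_mass_blowup_pos hpos)), mul_comm]
  exact hn.2

end SphereCovering

end

theorem corollary3 {A : Type*} [Fintype A] (P : A → ℝ) (hP : P ∈ stdSimplex ℝ A)
    (hPpos : ∀ a, 0 < P a) (ρ : A → A → ℝ) (hρ : ∀ a b, 0 ≤ ρ a b)
    (hρ0 : ∀ a, ∃ b, ρ a b = 0) :
    (∀ n : ℕ, 1 ≤ n → ∀ (C : Finset (Fin n → A)) (hC : C.Nonempty) (D : ℝ),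
      D = SphereCovering.avgDistortion P ρ C hC →
      EReal.exp ((n : EReal) * SphereCovering.concExponent ρ P D) ≤
        ENNReal.ofReal (SphereCovering.mass P C)) ∧
    (∀ D : ℝ, 0 ≤ D → ∀ C : (n : ℕ) → Finset (Fin n → A),
      Tendsto (fun n => SphereCovering.mass P (SphereCovering.blowup ρ D (C n))) atTop (𝓝 1) →
      SphereCovering.concExponent ρ P D ≤
        liminf (fun n : ℕ =>
          (((1 / (n : ℝ)) * Real.log (SphereCovering.mass P (C n)) : ℝ) : EReal)) atTop) ∧
    (∀ D : ℝ, 0 ≤ D → ∃ C : (n : ℕ) → Finset (Fin n → A),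
      Tendsto (fun n => SphereCovering.mass P (SphereCovering.blowup ρ D (C n))) atTop (𝓝 1) ∧
      Tendsto (fun n : ℕ =>
          (((1 / (n : ℝ)) * Real.log (SphereCovering.mass P (C n)) : ℝ) : EReal)) atTop
        (𝓝 (SphereCovering.concExponent ρ P D))) := by
  refine ⟨fun n hn C hC D hD => ?_, fun D hD C hC => ?_, fun D hD => ?_⟩
  · subst hD
    exact SphereCovering.exp_mul_concExponent_le_mass hP hPpos hn hC
  · exact SphereCovering.concExponent_le_liminf hP hPpos hρ hD hC
  · exact SphereCovering.exists_seq_tendsto_concExponent hP hPpos hρ hρ0 hD
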